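/- Let $(N,h,J)$ be an almost Hermitian manifold, i.e. a finite-dimensional smooth manifold $N$ (without boundary) with a smooth Riemannian metric $h$ and a smooth almost complex structure $J$ such that $h(JX,JY)=h(X,Y)$. Let $\nabla$ be the Levi-Civita connection of $h$, and let $\nabla^c$ be the Chern connection of $(N,h,J)$, which is given by $$h(\nabla^c_XY,Z)=h(\nabla_XY,Z)+\tfrac12 h((\nabla_XJ)(JY),Z)+\tfrac14 h\big((\nabla_ZJ)(JY)-(\nabla_YJ)(JZ)-(\nabla_{JZ}J)(Y)+(\nabla_{JY}J)(Z),\,X\big).$$ For a connection $D$ on $TN$ put $R^D(X,Y)Z=D_{[X,Y]}Z-(D_XD_YZ-D_YD_XZ)$. The holomorphic bisectional curvature $H$ and the Hermitian bisectional curvature $H^c$ of $(N,h,J)$ are $$H(X,Y)=h(R^{\nabla}(X,JX)Y,JY),\qquad H^c(X,Y)=h(R^{\nabla^c}(X,JX)Y,JY)$$ for unit tangent vectors $X,Y$ at the same point. The manifold is Kähler if $J$ is integrable (its Nijenhuis tensor vanishes) and the Kähler form $\Omega(X,Y)=h(JX,Y)$ is closed. Let $\varepsilon\in\{1,-1\}$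 and suppose that $$(\nabla_XJ)(X)=\varepsilon\,(\nabla_{JX}J)(JX)\qquad\text{for all tangent vectors } X.$$ Then $H(X,Y)=H^c(X,Y)$ for all $p\in N$ and all unit vectors $X,Y\in T_pN$ if and only if $(N,h,J)$ is a Kähler manifold. -/

import Mathlib

open Bundle FiberBundle VectorField
open scoped Manifold ContDiff

noncomputable section

namespace AlmostHermitian

section

set_option linter.unusedSectionVars false

variable {E : Type*} [NormedAddCommGroup E] [NormedSpace ℝ E]
  {M : Type*} [TopologicalSpace M] [ChartedSpace E M] [IsManifold 𝓘(ℝ, E) ∞ M]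
  [RiemannianBundle (fun x : M ↦ TangentSpace 𝓘(ℝ, E) x)]
  [IsContMDiffRiemannianBundle 𝓘(ℝ, E) ∞ E (fun x : M ↦ TangentSpace 𝓘(ℝ, E) x)]

/-! ### The Levi-Civita connection -/

/-- The right-hand side of the Koszul formula
`2 g(∇_X Y, Z) = X g(Y,Z) + Y g(X,Z) - Z g(X,Y) + g([X,Y],Z) - g([X,Z],Y) - g([Y,Z],X)`
at the point `x`. -/
def koszul (X Y Z : Π x : M, TangentSpace 𝓘(ℝ, E) x) (x : M) : ℝ :=
  d% (fun y ↦ inner ℝ (Y y) (Z y)) x (X x)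
    + d% (fun y ↦ inner ℝ (X y) (Z y)) x (Y x)
    - d% (fun y ↦ inner ℝ (X y) (Y y)) x (Z x)
    + inner ℝ (mlieBracket 𝓘(ℝ, E) X Y x) (Z x)
    - inner ℝ (mlieBracket 𝓘(ℝ, E) X Z x) (Y x)
    - inner ℝ (mlieBracket 𝓘(ℝ, E) Y Z x) (X x)

/-- The function `g(X, Y)` is differentiable at a point where the vector fields `X`, `Y` are. -/
theorem mdifferentiableAt_inner {X Y : Π x : M, TangentSpace 𝓘(ℝ, E) x} {x : M}
    (hX : MDiffAt (T% X) x) (hY : MDiffAt (T% Y) x) :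
    MDiffAt (fun y ↦ (inner ℝ (X y) (Y y) : ℝ)) x :=
  MDifferentiableAt.inner_bundle (IB := 𝓘(ℝ, E)) (F := E)
    (E := fun x : M ↦ TangentSpace 𝓘(ℝ, E) x) (b := fun y : M ↦ y) hX hY

variable [FiniteDimensional ℝ E]

theorem koszul_tensorialAt_left {Y Z : Π x : M, TangentSpace 𝓘(ℝ, E) x} {x : M}
    (hY : MDiffAt (T% Y) x) (hZ : MDiffAt (T% Z) x) :
    TensorialAt 𝓘(ℝ, E) E (fun X ↦ koszul X Y Z x) x where
  smul {f X} hf hX := by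
    have h1 := mvfderiv_fun_mul hf (mdifferentiableAt_inner hX hZ)
    have h2 := mvfderiv_fun_mul hf (mdifferentiableAt_inner hX hY)
    simp [koszul, inner_smul_left, inner_add_left, inner_smul_right, h1, h2,
      mlieBracket_smul_left hf hX]
    ring
  add {X X'} hX hX' := by
    have h1 := mvfderiv_fun_add (mdifferentiableAt_inner hX hZ) (mdifferentiableAt_inner hX' hZ)
    have h2 := mvfderiv_fun_add (mdifferentiableAt_inner hX hY) (mdifferentiableAt_inner hX' hY)
    simp [koszul, inner_add_left, inner_add_right, h1, h2, mlieBracket_add_left hX hX']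
    ring

theorem koszul_tensorialAt_right {X Y : Π x : M, TangentSpace 𝓘(ℝ, E) x} {x : M}
    (hX : MDiffAt (T% X) x) (hY : MDiffAt (T% Y) x) :
    TensorialAt 𝓘(ℝ, E) E (fun Z ↦ koszul X Y Z x) x where
  smul {f Z} hf hZ := by
    have h1 := mvfderiv_fun_mul hf (mdifferentiableAt_inner hX hZ)
    have h2 := mvfderiv_fun_mul hf (mdifferentiableAt_inner hY hZ)
    simp [koszul, inner_smul_left, inner_add_left, inner_smul_right, h1, h2,
      mlieBracket_smul_right hf hZ, real_inner_comm]
    ring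
  add {Z Z'} hZ hZ' := by
    have h1 := mvfderiv_fun_add (mdifferentiableAt_inner hX hZ) (mdifferentiableAt_inner hX hZ')
    have h2 := mvfderiv_fun_add (mdifferentiableAt_inner hY hZ) (mdifferentiableAt_inner hY hZ')
    simp [koszul, inner_add_left, inner_add_right, h1, h2, mlieBracket_add_right hZ hZ']
    ring

/-- For a vector field `Y` differentiable at `x`, the bilinear form on `T_x M` that sends the values
`X x`, `Z x` to half of the Koszul expression of `X, Y, Z`. -/
def koszulForm (Y : Π x : M, TangentSpace 𝓘(ℝ, E) x) (x : M) (hY : MDiffAt (T% Y) x) :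
    TangentSpace 𝓘(ℝ, E) x →L[ℝ] TangentSpace 𝓘(ℝ, E) x →L[ℝ] ℝ :=
  (2⁻¹ : ℝ) • TensorialAt.mkHom₂ (I := 𝓘(ℝ, E)) (F := E) (F' := E)
    (fun X Z ↦ koszul X Y Z x) x
    (fun _ hZ ↦ koszul_tensorialAt_left hY hZ) (fun _ hX ↦ koszul_tensorialAt_right hX hY)

theorem koszulForm_apply {X Y Z : Π x : M, TangentSpace 𝓘(ℝ, E) x} {x : M}
    (hX : MDiffAt (T% X) x) (hY : MDiffAt (T% Y) x) (hZ : MDiffAt (T% Z) x) :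
    koszulForm Y x hY (X x) (Z x) = 2⁻¹ * koszul X Y Z x := by
  simp [koszulForm, TensorialAt.mkHom₂_apply _ _ hX hZ]

instance instFiniteDimensionalTangentSpace (x : M) :
    FiniteDimensional ℝ (TangentSpace 𝓘(ℝ, E) x) :=
  inferInstanceAs (FiniteDimensional ℝ E)

instance instCompleteSpaceTangentSpace (x : M) : CompleteSpace (TangentSpace 𝓘(ℝ, E) x) :=
  FiniteDimensional.complete ℝ _

open Classical in
/-- The endomorphism `X ↦ ∇_X Y` of `T_x M`, where `g(∇_X Y, Z)` is given by the Koszul formula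
(and `0` if `Y` is not differentiable at `x`). -/
def leviCivitaFun (Y : Π x : M, TangentSpace 𝓘(ℝ, E) x) (x : M) :
    TangentSpace 𝓘(ℝ, E) x →L[ℝ] TangentSpace 𝓘(ℝ, E) x :=
  if hY : MDiffAt (T% Y) x then
    InnerProductSpace.continuousLinearMapOfBilin (𝕜 := ℝ) (koszulForm Y x hY)
  else 0

theorem inner_leviCivitaFun {X Y Z : Π x : M, TangentSpace 𝓘(ℝ, E) x} {x : M}
    (hX : MDiffAt (T% X) x) (hY : MDiffAt (T% Y) x) (hZ : MDiffAt (T% Z) x) :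
    (inner ℝ (leviCivitaFun Y x (X x)) (Z x) : ℝ) = 2⁻¹ * koszul X Y Z x := by
  rw [leviCivitaFun, dif_pos hY, ← koszulForm_apply hX hY hZ]
  exact InnerProductSpace.continuousLinearMapOfBilin_apply (𝕜 := ℝ) (koszulForm Y x hY) _ _

/-- The Levi-Civita connection `∇` of the Riemannian metric of `M`, given by the Koszul formula. As
for every `CovariantDerivative`, `leviCivita Y x (X x)` is `(∇_X Y)(x)`. -/
def leviCivita : CovariantDerivative 𝓘(ℝ, E) E (fun x : M ↦ TangentSpace 𝓘(ℝ, E) x) where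
  toFun := leviCivitaFun
  isCovariantDerivativeOnUniv :=
    { add := by
        intro Y Y' x hY hY' _
        have hs : MDiffAt (T% (Y + Y')) x := mdifferentiableAt_add_section hY hY'
        ext v
        refine ext_inner_right ℝ fun w ↦ ?_
        have hv := mdifferentiableAt_extend (V := fun x : M ↦ TangentSpace 𝓘(ℝ, E) x) 𝓘(ℝ, E) E v
        have hw := mdifferentiableAt_extend (V := fun x : M ↦ TangentSpace 𝓘(ℝ, E) x) 𝓘(ℝ, E) E w
        have h1 := mvfderiv_fun_add (mdifferentiableAt_inner hY hw) (mdifferentiableAt_inner hY' hw)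
        have h2 := mvfderiv_fun_add (mdifferentiableAt_inner hv hY) (mdifferentiableAt_inner hv hY')
        have e := inner_leviCivitaFun hv hs hw
        have e1 := inner_leviCivitaFun hv hY hw
        have e2 := inner_leviCivitaFun hv hY' hw
        simp only [extend_apply_self] at e e1 e2
        simp only [add_apply, inner_add_left, e, e1, e2]
        simp [koszul, inner_add_left, inner_add_right, h1, h2, mlieBracket_add_left hY hY',
          mlieBracket_add_right hY hY']
        ring
      leibniz := by
        intro Y f x hY hf _
        have hs : MDiffAt (T% (f • Y)) x := hf.smul_section hY
        ext v
        refine ext_inner_right ℝ fun w ↦ ?_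
        have hv := mdifferentiableAt_extend (V := fun x : M ↦ TangentSpace 𝓘(ℝ, E) x) 𝓘(ℝ, E) E v
        have hw := mdifferentiableAt_extend (V := fun x : M ↦ TangentSpace 𝓘(ℝ, E) x) 𝓘(ℝ, E) E w
        have h1 := mvfderiv_fun_mul hf (mdifferentiableAt_inner hY hw)
        have h2 := mvfderiv_fun_mul hf (mdifferentiableAt_inner hv hY)
        have e := inner_leviCivitaFun hv hs hw
        have e1 := inner_leviCivitaFun hv hY hw
        simp only [extend_apply_self] at e e1
        simp only [add_apply, smul_apply, ContinuousLinearMap.smulRight_apply, inner_add_left, inner_smul_left, e, e1]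
        simp [koszul, inner_smul_left, inner_smul_right, inner_add_left, h1, h2,
          mlieBracket_smul_left hf hY, mlieBracket_smul_right hf hY]
        rw [real_inner_comm (Y x) v]
        ring }

/-- The Levi-Civita connection is metric: `X g(Y, Z) = g(∇_X Y, Z) + g(Y, ∇_X Z)`. -/
theorem leviCivita_metric {X Y Z : Π x : M, TangentSpace 𝓘(ℝ, E) x} {x : M}
    (hX : MDiffAt (T% X) x) (hY : MDiffAt (T% Y) x) (hZ : MDiffAt (T% Z) x) :
    d% (fun y ↦ (inner ℝ (Y y) (Z y) : ℝ)) x (X x) =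
      inner ℝ (leviCivita Y x (X x)) (Z x) + inner ℝ (Y x) (leviCivita Z x (X x)) := by
  have e1 := inner_leviCivitaFun hX hY hZ
  have e2 := inner_leviCivitaFun hX hZ hY
  have h3 : (inner ℝ (Y x) (leviCivitaFun Z x (X x)) : ℝ) = _ := (real_inner_comm _ _).trans e2
  change _ = (inner ℝ (leviCivitaFun Y x (X x)) (Z x) : ℝ) + inner ℝ (Y x) (leviCivitaFun Z x (X x))
  rw [e1, h3]
  have h4 := mlieBracket_swap_apply (I := 𝓘(ℝ, E)) (V := Z) (W := Y) (x := x)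
  have h5 : (fun y ↦ inner ℝ (Z y) (Y y) : M → ℝ) = fun y ↦ inner ℝ (Y y) (Z y) :=
    funext fun y ↦ real_inner_comm _ _
  simp only [koszul, h4, h5, inner_neg_left]
  ring

/-- The Levi-Civita connection is torsion-free. -/
theorem leviCivita_torsion : (leviCivita (E := E) (M := M)).torsion = 0 := by
  rw [CovariantDerivative.torsion_eq_zero_iff]
  intro X Y x hX hY
  refine ext_inner_right ℝ fun w ↦ ?_
  have hw := mdifferentiableAt_extend (V := fun x : M ↦ TangentSpace 𝓘(ℝ, E) x) 𝓘(ℝ, E) E w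
  have e1 := inner_leviCivitaFun hX hY hw
  have e2 := inner_leviCivitaFun hY hX hw
  simp only [extend_apply_self] at e1 e2
  change (inner ℝ (leviCivitaFun Y x (X x) - leviCivitaFun X x (Y x)) w : ℝ) = _
  rw [inner_sub_left, e1, e2]
  have h4 := mlieBracket_swap_apply (I := 𝓘(ℝ, E)) (V := Y) (W := X) (x := x)
  have h5 : (fun y ↦ inner ℝ (Y y) (X y) : M → ℝ) = fun y ↦ inner ℝ (X y) (Y y) :=
    funext fun y ↦ real_inner_comm _ _
  simp only [koszul, h4, h5, inner_neg_left, extend_apply_self]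
  ring

/-! ### Almost Hermitian structures -/

/-- `J` is an almost complex structure on the Riemannian manifold `M` that is smooth and orthogonal
with respect to the metric, so that `M` with its metric and `J` is an almost Hermitian manifold. -/
structure IsAlmostHermitian
    (J : Π x : M, TangentSpace 𝓘(ℝ, E) x →L[ℝ] TangentSpace 𝓘(ℝ, E) x) : Prop where
  contMDiff : ContMDiff 𝓘(ℝ, E) (𝓘(ℝ, E).prod 𝓘(ℝ, E →L[ℝ] E)) ∞
    (fun x ↦ TotalSpace.mk' (E →L[ℝ] E)
      (E := fun x : M ↦ TangentSpace 𝓘(ℝ, E) x →L[ℝ] TangentSpace 𝓘(ℝ, E) x) x (J x))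
  apply_apply (x : M) (v : TangentSpace 𝓘(ℝ, E) x) : J x (J x v) = -v
  inner_apply (x : M) (v w : TangentSpace 𝓘(ℝ, E) x) :
    (inner ℝ (J x v) (J x w) : ℝ) = inner ℝ v w

variable {J : Π x : M, TangentSpace 𝓘(ℝ, E) x →L[ℝ] TangentSpace 𝓘(ℝ, E) x}

theorem IsAlmostHermitian.mdifferentiableAt_apply (hJ : IsAlmostHermitian J)
    {Y : Π x : M, TangentSpace 𝓘(ℝ, E) x} {x : M} (hY : MDiffAt (T% Y) x) :
    MDiffAt (T% (fun y ↦ J y (Y y))) x :=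
  MDifferentiableAt.clm_bundle_apply (F₁ := E) (F₂ := E)
    (E₁ := fun x : M ↦ TangentSpace 𝓘(ℝ, E) x) (E₂ := fun x : M ↦ TangentSpace 𝓘(ℝ, E) x)
    (b := fun y : M ↦ y)
    (hJ.contMDiff.mdifferentiable (by simp) x) hY

/-- For a vector field `Y`, the endomorphism `X ↦ (∇_X J) Y = ∇_X (J Y) - J (∇_X Y)` of `T_x M`. -/
def nablaJAux (J : Π x : M, TangentSpace 𝓘(ℝ, E) x →L[ℝ] TangentSpace 𝓘(ℝ, E) x)
    (Y : Π x : M, TangentSpace 𝓘(ℝ, E) x) (x : M) :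
    TangentSpace 𝓘(ℝ, E) x →L[ℝ] TangentSpace 𝓘(ℝ, E) x :=
  leviCivita (fun y ↦ J y (Y y)) x - J x ∘L leviCivita Y x

theorem nablaJAux_tensorialAt (hJ : IsAlmostHermitian J) (x : M) :
    TensorialAt 𝓘(ℝ, E) E (fun Y ↦ nablaJAux J Y x) x where
  smul {f Y} hf hY := by
    have h : (fun y ↦ J y ((f • Y) y)) = f • fun y ↦ J y (Y y) := by ext y; simp
    have e1 := leviCivita.isCovariantDerivativeOnUniv.leibniz hY hf
    have e2 := leviCivita.isCovariantDerivativeOnUniv.leibniz (hJ.mdifferentiableAt_apply hY) hf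
    simp only [nablaJAux, h, e1, e2]
    ext v
    simp
    module
  add {Y Y'} hY hY' := by
    have h : (fun y ↦ J y ((Y + Y') y)) = (fun y ↦ J y (Y y)) + fun y ↦ J y (Y' y) := by
      ext y; simp
    have e1 := leviCivita.isCovariantDerivativeOnUniv.add hY hY'
    have e2 := leviCivita.isCovariantDerivativeOnUniv.add (hJ.mdifferentiableAt_apply hY)
      (hJ.mdifferentiableAt_apply hY')
    simp only [nablaJAux, h, e1, e2]
    ext v
    simp
    module

/-- The covariant derivative `∇J` of the almost complex structure with respect to the Levi-Civita
connection: `nablaJ hJ x Y X` is `(∇_X J) Y`, for `X, Y` in `T_x M` (in this order of the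
arguments). -/
def nablaJ (hJ : IsAlmostHermitian J) (x : M) :
    TangentSpace 𝓘(ℝ, E) x →L[ℝ] TangentSpace 𝓘(ℝ, E) x →L[ℝ] TangentSpace 𝓘(ℝ, E) x :=
  TensorialAt.mkHom (I := 𝓘(ℝ, E)) (F := E) (fun Y ↦ nablaJAux J Y x) x (nablaJAux_tensorialAt hJ x)

theorem nablaJ_apply (hJ : IsAlmostHermitian J) {x : M} {Y : Π x : M, TangentSpace 𝓘(ℝ, E) x}
    (hY : MDiffAt (T% Y) x) (v : TangentSpace 𝓘(ℝ, E) x) :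
    nablaJ hJ x (Y x) v = leviCivita (fun y ↦ J y (Y y)) x v - J x (leviCivita Y x v) := by
  rw [nablaJ, TensorialAt.mkHom_apply _ hY]
  rfl

/-! ### The Chern connection -/

/-- The trilinear form
`g((∇_Z J)(JY) - (∇_Y J)(JZ) - (∇_{JZ} J)(Y) + (∇_{JY} J)(Z), X)` on `T_x M`. -/
def chernForm (hJ : IsAlmostHermitian J) (x : M) (X Y Z : TangentSpace 𝓘(ℝ, E) x) : ℝ :=
  inner ℝ (nablaJ hJ x (J x Y) Z - nablaJ hJ x (J x Z) Y - nablaJ hJ x Y (J x Z)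
    + nablaJ hJ x Z (J x Y)) X

/-- For `Y` in `T_x M`, the form `chernForm` as a bilinear form in `X` and `Z`. -/
def chernBilin (hJ : IsAlmostHermitian J) (x : M) (Y : TangentSpace 𝓘(ℝ, E) x) :
    TangentSpace 𝓘(ℝ, E) x →L[ℝ] TangentSpace 𝓘(ℝ, E) x →L[ℝ] ℝ :=
  (LinearMap.mk₂ ℝ (fun X Z ↦ chernForm hJ x X Y Z)
    (fun X X' Z ↦ by simp [chernForm, inner_add_right])
    (fun c X Z ↦ by simp [chernForm, inner_smul_right])
    (fun X Z Z' ↦ by simp [chernForm, inner_add_left, inner_sub_left]; ring)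
    (fun c X Z ↦ by
      simp [chernForm, inner_add_left, inner_sub_left, inner_smul_left]; ring)).toContinuousBilinearMap

theorem inner_chernBilin (hJ : IsAlmostHermitian J) (x : M)
    (X Y Z : TangentSpace 𝓘(ℝ, E) x) :
    (inner ℝ (InnerProductSpace.continuousLinearMapOfBilin (𝕜 := ℝ) (chernBilin hJ x Y) X) Z : ℝ) =
      chernForm hJ x X Y Z :=
  InnerProductSpace.continuousLinearMapOfBilin_apply (𝕜 := ℝ) (chernBilin hJ x Y) X Z

/-- The difference `∇^c - ∇` of the Chern and the Levi-Civita connection: `chernDiff hJ x Y X` is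
the value of `∇^c_X Y - ∇_X Y` at `x`. -/
def chernDiff (hJ : IsAlmostHermitian J) (x : M) :
    TangentSpace 𝓘(ℝ, E) x →L[ℝ] TangentSpace 𝓘(ℝ, E) x →L[ℝ] TangentSpace 𝓘(ℝ, E) x :=
  LinearMap.toContinuousLinearMap
    { toFun Y := (2⁻¹ : ℝ) • nablaJ hJ x (J x Y)
        + (4⁻¹ : ℝ) • InnerProductSpace.continuousLinearMapOfBilin (𝕜 := ℝ) (chernBilin hJ x Y)
      map_add' Y Y' := by
        ext X
        refine ext_inner_right ℝ fun Z ↦ ?_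
        simp only [add_apply, smul_apply, inner_add_left, inner_smul_left, inner_chernBilin]
        simp [chernForm, inner_add_left, inner_sub_left]
        ring
      map_smul' c Y := by
        ext X
        refine ext_inner_right ℝ fun Z ↦ ?_
        simp only [add_apply, smul_apply, inner_add_left, inner_smul_left, inner_chernBilin]
        simp [chernForm, inner_add_left, inner_sub_left, inner_smul_left]
        ring }

/-- The Chern connection `∇^c` of an almost Hermitian manifold. -/
def chern (hJ : IsAlmostHermitian J) :
    CovariantDerivative 𝓘(ℝ, E) E (fun x : M ↦ TangentSpace 𝓘(ℝ, E) x) :=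
  leviCivita.addOneForm (chernDiff hJ)

/-- The formula that defines the Chern connection:
`g(∇^c_X Y, Z) = g(∇_X Y, Z) + 1/2 g((∇_X J)(JY), Z)
+ 1/4 g((∇_Z J)(JY) - (∇_Y J)(JZ) - (∇_{JZ} J)(Y) + (∇_{JY} J)(Z), X)`. -/
theorem inner_chern (hJ : IsAlmostHermitian J) (Y : Π x : M, TangentSpace 𝓘(ℝ, E) x) (x : M)
    (X Z : TangentSpace 𝓘(ℝ, E) x) :
    (inner ℝ (chern hJ Y x X) Z : ℝ) = inner ℝ (leviCivita Y x X) Z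
      + 1 / 2 * inner ℝ (nablaJ hJ x (J x (Y x)) X) Z
      + 1 / 4 * inner ℝ (nablaJ hJ x (J x (Y x)) Z - nablaJ hJ x (J x Z) (Y x)
          - nablaJ hJ x (Y x) (J x Z) + nablaJ hJ x Z (J x (Y x))) X := by
  have h : chern hJ Y x X = leviCivita Y x X + ((2⁻¹ : ℝ) • nablaJ hJ x (J x (Y x)) X + (4⁻¹ : ℝ) •
      InnerProductSpace.continuousLinearMapOfBilin (𝕜 := ℝ) (chernBilin hJ x (Y x)) X) := rfl
  rw [h]
  simp only [inner_add_left, inner_smul_left, inner_chernBilin, chernForm]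
  simp
  ring

/-! ### Curvature -/

/-- The curvature `R(X, Y) Z = ∇_{[X,Y]} Z - (∇_X ∇_Y Z - ∇_Y ∇_X Z)` of a connection `∇` on the
tangent bundle, for vector fields `X`, `Y`, `Z`. With this sign, `g(R(X, Y) X, Y)` is the sectional
curvature of the plane with orthonormal basis `X, Y` if `∇` is the Levi-Civita connection. -/
def curvature (cov : CovariantDerivative 𝓘(ℝ, E) E (fun x : M ↦ TangentSpace 𝓘(ℝ, E) x))
    (X Y Z : Π x : M, TangentSpace 𝓘(ℝ, E) x) (x : M) : TangentSpace 𝓘(ℝ, E) x :=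
  cov Z x (mlieBracket 𝓘(ℝ, E) X Y x)
    - (cov (fun y ↦ cov Z y (Y y)) x (X x) - cov (fun y ↦ cov Z y (X y)) x (Y x))

/-- The curvature tensor `R(u, v) w` of a connection at `x`, for tangent vectors `u, v, w` at `x`:
these are extended to the vector fields that are constant in the preferred trivialization of the
tangent bundle at `x`. The curvature of a smooth connection is tensorial, so other smooth extensions
give the same value. -/
def curvatureAt (cov : CovariantDerivative 𝓘(ℝ, E) E (fun x : M ↦ TangentSpace 𝓘(ℝ, E) x))
    (x : M) (u v w : TangentSpace 𝓘(ℝ, E) x) : TangentSpace 𝓘(ℝ, E) x :=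
  curvature cov (extend E u) (extend E v) (extend E w) x

/-- The holomorphic bisectional curvature `g(R(u, Ju) v, Jv)`, for unit tangent vectors `u, v`, of
a connection on the tangent bundle. -/
def bisectionalCurvature (J : Π x : M, TangentSpace 𝓘(ℝ, E) x →L[ℝ] TangentSpace 𝓘(ℝ, E) x)
    (cov : CovariantDerivative 𝓘(ℝ, E) E (fun x : M ↦ TangentSpace 𝓘(ℝ, E) x))
    (x : M) (u v : TangentSpace 𝓘(ℝ, E) x) : ℝ :=
  inner ℝ (curvatureAt cov x u (J x u) v) (J x v)

/-- The holomorphic bisectional curvature of the manifold: that of its Levi-Civita connection. -/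
def holomorphicBisectionalCurvature
    (J : Π x : M, TangentSpace 𝓘(ℝ, E) x →L[ℝ] TangentSpace 𝓘(ℝ, E) x)
    (x : M) (u v : TangentSpace 𝓘(ℝ, E) x) : ℝ :=
  bisectionalCurvature J leviCivita x u v

/-- The Hermitian bisectional curvature: the holomorphic bisectional curvature of the Chern
connection. -/
def hermitianBisectionalCurvature (hJ : IsAlmostHermitian J)
    (x : M) (u v : TangentSpace 𝓘(ℝ, E) x) : ℝ :=
  bisectionalCurvature J (chern hJ) x u v

/-! ### Kähler manifolds -/

/-- The Kähler form `Ω(X, Y) = g(JX, Y)` on vector fields. -/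
def kahlerForm (J : Π x : M, TangentSpace 𝓘(ℝ, E) x →L[ℝ] TangentSpace 𝓘(ℝ, E) x)
    (X Y : Π x : M, TangentSpace 𝓘(ℝ, E) x) (x : M) : ℝ :=
  inner ℝ (J x (X x)) (Y x)

/-- The exterior derivative `dΩ` of the Kähler form on vector fields, by the invariant formula
`dΩ(X,Y,Z) = X Ω(Y,Z) + Y Ω(Z,X) + Z Ω(X,Y) - Ω([X,Y],Z) - Ω([Y,Z],X) - Ω([Z,X],Y)`. -/
def dKahlerForm (J : Π x : M, TangentSpace 𝓘(ℝ, E) x →L[ℝ] TangentSpace 𝓘(ℝ, E) x)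
    (X Y Z : Π x : M, TangentSpace 𝓘(ℝ, E) x) (x : M) : ℝ :=
  d% (kahlerForm J Y Z) x (X x) + d% (kahlerForm J Z X) x (Y x) + d% (kahlerForm J X Y) x (Z x)
    - kahlerForm J (mlieBracket 𝓘(ℝ, E) X Y) Z x
    - kahlerForm J (mlieBracket 𝓘(ℝ, E) Y Z) X x
    - kahlerForm J (mlieBracket 𝓘(ℝ, E) Z X) Y x

/-- The Nijenhuis tensor `N(X, Y) = [JX, JY] - J[JX, Y] - J[X, JY] - [X, Y]` on vector fields. -/
def nijenhuis (J : Π x : M, TangentSpace 𝓘(ℝ, E) x →L[ℝ] TangentSpace 𝓘(ℝ, E) x)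
    (X Y : Π x : M, TangentSpace 𝓘(ℝ, E) x) (x : M) : TangentSpace 𝓘(ℝ, E) x :=
  mlieBracket 𝓘(ℝ, E) (fun y ↦ J y (X y)) (fun y ↦ J y (Y y)) x
    - J x (mlieBracket 𝓘(ℝ, E) (fun y ↦ J y (X y)) Y x)
    - J x (mlieBracket 𝓘(ℝ, E) X (fun y ↦ J y (Y y)) x)
    - mlieBracket 𝓘(ℝ, E) X Y x

/-- An almost Hermitian manifold is Kähler if its almost complex structure is integrable, that is,
has vanishing Nijenhuis tensor, and its Kähler form is closed. The vector fields are only required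
to be smooth near the point considered. -/
structure IsKahler (J : Π x : M, TangentSpace 𝓘(ℝ, E) x →L[ℝ] TangentSpace 𝓘(ℝ, E) x) :
    Prop extends IsAlmostHermitian J where
  nijenhuis_eq_zero (x : M) (X Y : Π x : M, TangentSpace 𝓘(ℝ, E) x)
    (hX : CMDiffAt ∞ (T% X) x) (hY : CMDiffAt ∞ (T% Y) x) : nijenhuis J X Y x = 0
  dKahlerForm_eq_zero (x : M) (X Y Z : Π x : M, TangentSpace 𝓘(ℝ, E) x)
    (hX : CMDiffAt ∞ (T% X) x) (hY : CMDiffAt ∞ (T% Y) x) (hZ : CMDiffAt ∞ (T% Z) x) :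
    dKahlerForm J X Y Z x = 0

end

end AlmostHermitian

end

noncomputable section

namespace AlmostHermitian

section

set_option linter.unusedSectionVars false

variable {E : Type*} [NormedAddCommGroup E] [NormedSpace ℝ E]
  {M : Type*} [TopologicalSpace M] [ChartedSpace E M] [IsManifold 𝓘(ℝ, E) ∞ M]
  [RiemannianBundle (fun x : M ↦ TangentSpace 𝓘(ℝ, E) x)]
  [IsContMDiffRiemannianBundle 𝓘(ℝ, E) ∞ E (fun x : M ↦ TangentSpace 𝓘(ℝ, E) x)]
  [FiniteDimensional ℝ E]
  {J : Π x : M, TangentSpace 𝓘(ℝ, E) x →L[ℝ] TangentSpace 𝓘(ℝ, E) x}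

/-! ### Smoothness of the Levi-Civita connection and of the Chern connection -/

/-! Write `∇^c = ∇ + A`, where `A_X Y` is `chernDiff hJ x Y X`. With the sign convention used here,
`R^∇ - R^c` is the exterior covariant derivative of `A` plus a term quadratic in `A`
(`curvature_leviCivita_sub_curvature_chern`). Its pairing with `JY` a priori involves second
derivatives of `J`. The point is that the hypothesis on `∇J` removes them, because `g(A_X Y, JY) =
1/2 g((∇_Y J)Y + (∇_{JY} J)(JY), X)`.

For `ε = -1` (quasi-Kähler) this function vanishes identically, so metric compatibility turns each
derivative of `A` into an algebraic term. As `A_X Y = -1/2 J (∇_X J)Y` in this case, the result is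
`H - H^c = 1/2 |(∇_X J)Y|²`. For `ε = 1` (class `G₁`) the same works only on the diagonal `X = Y`:
with `P = (∇_X J)X`, which is orthogonal to `X` and `JX`, one gets `H - H^c = -|P|²`.

If `H = H^c` and `ε = 1`, the diagonal formula gives `P = 0`; then the condition for `ε = -1` holds
trivially, so the first formula applies for either sign and yields `∇J = 0`. It remains that `∇J =
0` is equivalent to being Kähler, and that the first formula with `∇J = 0` gives `H = H^c`.

Covariant derivatives add only on differentiable sections, so smoothness of `∇_X Y` and `A_X Y` has
to be established beforehand. -/

theorem contMDiffAt_inner {X Y : Π x : M, TangentSpace 𝓘(ℝ, E) x} {x : M}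
    (hX : CMDiffAt ∞ (T% X) x) (hY : CMDiffAt ∞ (T% Y) x) :
    CMDiffAt ∞ (fun y ↦ (inner ℝ (X y) (Y y) : ℝ)) x :=
  ContMDiffAt.inner_bundle (IB := 𝓘(ℝ, E)) (F := E)
    (E := fun x : M ↦ TangentSpace 𝓘(ℝ, E) x) (b := fun y : M ↦ y) hX hY

theorem contMDiffAt_det {ι : Type*} [Fintype ι] [DecidableEq ι] {x : M}
    {A : M → Matrix ι ι ℝ} (hA : ∀ i j, CMDiffAt ∞ (fun y ↦ A y i j) x) :
    CMDiffAt ∞ (fun y ↦ (A y).det) x := by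
  simp only [Matrix.det_apply']
  exact ContMDiffAt.sum fun σ _ ↦ contMDiffAt_const.mul (ContMDiffAt.prod fun i _ ↦ hA _ _)

/-- A vector field is smooth if its scalar products with smooth vector fields are. -/
theorem contMDiffAt_of_inner {W : Π x : M, TangentSpace 𝓘(ℝ, E) x} {x : M}
    (h : ∀ Z : Π x : M, TangentSpace 𝓘(ℝ, E) x, CMDiffAt ∞ (T% Z) x →
      CMDiffAt ∞ (fun y ↦ (inner ℝ (W y) (Z y) : ℝ)) x) :
    CMDiffAt ∞ (T% W) x := by
  classical
  let t := trivializationAt E (fun x : M ↦ TangentSpace 𝓘(ℝ, E) x) x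
  have hx : x ∈ t.baseSet := mem_baseSet_trivializationAt' x
  let b := Module.finBasis ℝ E
  let e := t.localFrame b
  have he (i) : CMDiffAt ∞ (T% (e i)) x := contMDiffAt_localFrame_of_mem ∞ t b i hx
  let G : M → Matrix _ _ ℝ := fun y ↦ Matrix.gram ℝ (fun i ↦ e i y)
  have hG (i j) : CMDiffAt ∞ (fun y ↦ G y i j) x := contMDiffAt_inner (he i) (he j)
  have hli (y) (hy : y ∈ t.baseSet) : (fun i ↦ e i y) = t.basisAt b hy :=
    funext fun i ↦ t.localFrame_apply_of_mem_baseSet b hy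
  have hdet (y) (hy : y ∈ t.baseSet) : (G y).det ≠ 0 := by
    refine (Matrix.posDef_gram_of_linearIndependent ?_).det_pos.ne'
    rw [hli y hy]
    exact (t.basisAt b hy).linearIndependent
  let φ : M → _ → ℝ := fun y i ↦ inner ℝ (W y) (e i y)
  -- The frame coefficients of `W` solve the linear system given by the Gram matrix `G` and the
  -- products `φ`. Cramer's rule expresses them through determinants with smooth entries and the
  -- nowhere vanishing `det G`.
  let c : _ → M → ℝ := fun i y ↦ (G y).det⁻¹ * (G y).cramer (φ y) i
  have hc (i) : CMDiffAt ∞ (c i) x := by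
    refine ContMDiffAt.mul ?_ ?_
    · exact (contDiffAt_inv ℝ (hdet x hx)).contMDiffAt.comp x (contMDiffAt_det hG)
    · simp only [Matrix.cramer_apply]
      refine contMDiffAt_det fun j k ↦ ?_
      by_cases hk : k = i
      · subst hk
        simpa [Matrix.updateCol_self] using h (e j) (he j)
      · simpa [Matrix.updateCol_ne hk] using hG j k
  have hs : CMDiffAt ∞ (T% (fun y ↦ ∑ i, c i y • e i y)) x :=
    ContMDiffAt.sum_section fun i _ ↦ (hc i).smul_section (he i)
  refine hs.congr_of_eventuallyEq ?_
  filter_upwards [t.open_baseSet.mem_nhds hx] with y hy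
  congr 1
  refine InnerProductSpace.ext_inner_left_basis (t.basisAt b hy) fun j ↦ ?_
  rw [← congrFun (hli y hy) j]
  have h1 := congrFun (Matrix.mulVec_cramer (G y) (φ y)) j
  simp only [Matrix.mulVec, dotProduct, Pi.smul_apply, smul_eq_mul] at h1
  rw [inner_sum, real_inner_comm]
  simp only [inner_smul_right, c, mul_assoc]
  rw [← Finset.mul_sum, eq_inv_mul_iff_mul_eq₀ (hdet y hy)]
  exact h1.symm.trans (Finset.sum_congr rfl fun i _ ↦ mul_comm _ _)

/-- The derivative of a smooth function along a smooth vector field is smooth. -/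
theorem contMDiffAt_mvfderiv_apply {f : M → ℝ} {V : Π x : M, TangentSpace 𝓘(ℝ, E) x} {x : M}
    (hf : CMDiffAt ∞ f x) (hV : CMDiffAt ∞ (T% V) x) :
    CMDiffAt ∞ (fun y ↦ d% f y (V y)) x := by
  have h1 := hf.mfderiv_const (m := ∞) (by simp)
  have h2 := ContMDiffAt.clm_apply_of_inCoordinates (F₁ := E) (F₂ := ℝ)
    (E₁ := fun x : M ↦ TangentSpace 𝓘(ℝ, E) x) (E₂ := fun x : ℝ ↦ TangentSpace 𝓘(ℝ, ℝ) x)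
    (b₁ := fun y : M ↦ y) (b₂ := f) (ϕ := mfderiv% f) (v := V) h1 hV hf
  exact (contMDiff_snd_tangentBundle_modelSpace ℝ 𝓘(ℝ, ℝ)).contMDiffAt.comp x h2

theorem contMDiffAt_mlieBracket {X Y : Π x : M, TangentSpace 𝓘(ℝ, E) x} {x : M}
    (hX : CMDiffAt ∞ (T% X) x) (hY : CMDiffAt ∞ (T% Y) x) :
    CMDiffAt ∞ (T% (mlieBracket 𝓘(ℝ, E) X Y)) x :=
  haveI : IsManifold 𝓘(ℝ, E) (minSmoothness ℝ 2) M := by simp; infer_instance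
  haveI : IsManifold 𝓘(ℝ, E) (((⊤ : ℕ∞) : WithTop ℕ∞) + 1) M := by simpa
  ContMDiffAt.mlieBracket_vectorField (m := ⊤) (n := ⊤) hX hY (by simp)

theorem contMDiffAt_koszul {X Y Z : Π x : M, TangentSpace 𝓘(ℝ, E) x} {x : M}
    (hX : CMDiffAt ∞ (T% X) x) (hY : CMDiffAt ∞ (T% Y) x) (hZ : CMDiffAt ∞ (T% Z) x) :
    CMDiffAt ∞ (koszul X Y Z) x := by
  have h1 := contMDiffAt_mvfderiv_apply (contMDiffAt_inner hY hZ) hX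
  have h2 := contMDiffAt_mvfderiv_apply (contMDiffAt_inner hX hZ) hY
  have h3 := contMDiffAt_mvfderiv_apply (contMDiffAt_inner hX hY) hZ
  have h4 := contMDiffAt_inner (contMDiffAt_mlieBracket hX hY) hZ
  have h5 := contMDiffAt_inner (contMDiffAt_mlieBracket hX hZ) hY
  have h6 := contMDiffAt_inner (contMDiffAt_mlieBracket hY hZ) hX
  exact ((((h1.add h2).sub h3).add h4).sub h5).sub h6

theorem eventually_mdifferentiableAt {X : Π x : M, TangentSpace 𝓘(ℝ, E) x} {x : M}
    (hX : CMDiffAt ∞ (T% X) x) : ∀ᶠ y in nhds x, MDiffAt (T% X) y := by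
  -- Being `C^∞` at a point means being `C^n` on a neighbourhood that may depend on `n`, so one
  -- passes to a finite order before spreading to nearby points.
  have h := ContMDiffAt.of_le hX (show (1 : WithTop ℕ∞) ≤ ∞ by simp)
  filter_upwards [(contMDiffAt_iff_contMDiffAt_nhds (by simp)).1 h] with y hy
  exact hy.mdifferentiableAt (by simp)

/-- Tested against a smooth field, `∇_X Y` is half the Koszul expression near `x`, and that
expression is smooth. -/
theorem contMDiffAt_leviCivita {X Y : Π x : M, TangentSpace 𝓘(ℝ, E) x} {x : M}
    (hX : CMDiffAt ∞ (T% X) x) (hY : CMDiffAt ∞ (T% Y) x) :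
    CMDiffAt ∞ (T% (fun y ↦ leviCivita Y y (X y))) x := by
  refine contMDiffAt_of_inner fun Z hZ ↦ ?_
  refine (contMDiffAt_const.mul (contMDiffAt_koszul hX hY hZ)).congr_of_eventuallyEq
    (f := fun y ↦ (2⁻¹ : ℝ) * koszul X Y Z y) ?_
  filter_upwards [eventually_mdifferentiableAt hX, eventually_mdifferentiableAt hY,
    eventually_mdifferentiableAt hZ] with y h1 h2 h3
  exact inner_leviCivitaFun h1 h2 h3

theorem IsAlmostHermitian.contMDiffAt_apply (hJ : IsAlmostHermitian J)
    {Y : Π x : M, TangentSpace 𝓘(ℝ, E) x} {x : M} (hY : CMDiffAt ∞ (T% Y) x) :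
    CMDiffAt ∞ (T% (fun y ↦ J y (Y y))) x :=
  ContMDiffAt.clm_bundle_apply (F₁ := E) (F₂ := E)
    (E₁ := fun x : M ↦ TangentSpace 𝓘(ℝ, E) x) (E₂ := fun x : M ↦ TangentSpace 𝓘(ℝ, E) x)
    (b := fun y : M ↦ y) (hJ.contMDiff x) hY

theorem contMDiffAt_nablaJ (hJ : IsAlmostHermitian J)
    {X Y : Π x : M, TangentSpace 𝓘(ℝ, E) x} {x : M}
    (hX : CMDiffAt ∞ (T% X) x) (hY : CMDiffAt ∞ (T% Y) x) :
    CMDiffAt ∞ (T% (fun y ↦ nablaJ hJ y (Y y) (X y))) x := by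
  have h := (contMDiffAt_leviCivita hX (hJ.contMDiffAt_apply hY)).sub_section
    (hJ.contMDiffAt_apply (contMDiffAt_leviCivita hX hY))
  refine h.congr_of_eventuallyEq ?_
  filter_upwards [eventually_mdifferentiableAt hY] with y hy
  congr 1
  exact nablaJ_apply hJ hy _

theorem inner_chernDiff (hJ : IsAlmostHermitian J) (x : M) (X Y Z : TangentSpace 𝓘(ℝ, E) x) :
    (inner ℝ (chernDiff hJ x Y X) Z : ℝ) =
      1 / 2 * inner ℝ (nablaJ hJ x (J x Y) X) Z + 1 / 4 * chernForm hJ x X Y Z := by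
  have h : chernDiff hJ x Y X = (2⁻¹ : ℝ) • nablaJ hJ x (J x Y) X + (4⁻¹ : ℝ) •
      InnerProductSpace.continuousLinearMapOfBilin (𝕜 := ℝ) (chernBilin hJ x Y) X := rfl
  rw [h, inner_add_left, inner_smul_left, inner_smul_left, inner_chernBilin]
  simp

theorem contMDiffAt_chernDiff (hJ : IsAlmostHermitian J)
    {X Y : Π x : M, TangentSpace 𝓘(ℝ, E) x} {x : M}
    (hX : CMDiffAt ∞ (T% X) x) (hY : CMDiffAt ∞ (T% Y) x) :
    CMDiffAt ∞ (T% (fun y ↦ chernDiff hJ y (Y y) (X y))) x := by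
  refine contMDiffAt_of_inner fun Z hZ ↦ ?_
  simp only [inner_chernDiff, chernForm]
  have hJY := hJ.contMDiffAt_apply hY
  have hJZ := hJ.contMDiffAt_apply hZ
  have h1 := contMDiffAt_nablaJ hJ hZ hJY
  have h2 := contMDiffAt_nablaJ hJ hY hJZ
  have h3 := contMDiffAt_nablaJ hJ hJZ hY
  have h4 := contMDiffAt_nablaJ hJ hJY hZ
  have h5 := ((h1.sub_section h2).sub_section h3).add_section h4
  exact (contMDiffAt_const.mul (contMDiffAt_inner (contMDiffAt_nablaJ hJ hX hJY) hZ)).add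
    (contMDiffAt_const.mul (contMDiffAt_inner h5 hX))

/-! ### The covariant derivative of the almost complex structure -/

theorem IsAlmostHermitian.inner_apply_left (hJ : IsAlmostHermitian J) (x : M)
    (v w : TangentSpace 𝓘(ℝ, E) x) : (inner ℝ (J x v) w : ℝ) = -inner ℝ v (J x w) := by
  rw [← hJ.inner_apply x v (J x w), hJ.apply_apply, inner_neg_right, neg_neg]

theorem mdifferentiableAt_extend' (x : M) (v : TangentSpace 𝓘(ℝ, E) x) :
    MDiffAt (T% (extend E v)) x :=
  mdifferentiableAt_extend (V := fun x : M ↦ TangentSpace 𝓘(ℝ, E) x) 𝓘(ℝ, E) E v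

theorem contMDiffAt_extend' (x : M) (v : TangentSpace 𝓘(ℝ, E) x) :
    CMDiffAt ∞ (T% (extend E v)) x :=
  contMDiffAt_extend (V := fun x : M ↦ TangentSpace 𝓘(ℝ, E) x) 𝓘(ℝ, E) E v

/-- The trilinear form `g((∇_X J) Y, Z)`. -/
def nablaForm (hJ : IsAlmostHermitian J) (x : M) (X Y Z : TangentSpace 𝓘(ℝ, E) x) : ℝ :=
  inner ℝ (nablaJ hJ x Y X) Z

/-- This is the covariant derivative of `J² = -1`. -/
theorem nablaJ_apply_J (hJ : IsAlmostHermitian J) (x : M) (X Y : TangentSpace 𝓘(ℝ, E) x) :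
    nablaJ hJ x (J x Y) X = -J x (nablaJ hJ x Y X) := by
  have hY := mdifferentiableAt_extend' x Y
  have hJY := hJ.mdifferentiableAt_apply hY
  have e1 := nablaJ_apply hJ hY X
  have e2 := nablaJ_apply hJ hJY X
  have h : (fun y ↦ J y (J y (extend E Y y))) = (-1 : ℝ) • extend E Y := by
    ext y; simp [hJ.apply_apply]
  have h3 := leviCivita.isCovariantDerivativeOnUniv.smul_const (-1 : ℝ) hY
  rw [h, h3] at e2
  simp only [extend_apply_self] at e1 e2
  rw [e1, e2, map_sub, hJ.apply_apply, smul_apply]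
  module

/-- This is the derivative of `g(JY, Z) = -g(Y, JZ)`, since `∇` is metric. -/
theorem nablaForm_skew (hJ : IsAlmostHermitian J) (x : M) (X Y Z : TangentSpace 𝓘(ℝ, E) x) :
    nablaForm hJ x X Y Z = -nablaForm hJ x X Z Y := by
  have hX := mdifferentiableAt_extend' x X
  have hY := mdifferentiableAt_extend' x Y
  have hZ := mdifferentiableAt_extend' x Z
  have m1 := leviCivita_metric hX (hJ.mdifferentiableAt_apply hY) hZ
  have m2 := leviCivita_metric hX hY (hJ.mdifferentiableAt_apply hZ)
  have h : (fun y ↦ (inner ℝ (J y (extend E Y y)) (extend E Z y) : ℝ)) =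
      -fun y ↦ inner ℝ (extend E Y y) (J y (extend E Z y)) :=
    funext fun y ↦ hJ.inner_apply_left y _ _
  rw [h, mvfderiv_neg] at m1
  have e1 := nablaJ_apply hJ hY X
  have e2 := nablaJ_apply hJ hZ X
  simp only [extend_apply_self, neg_apply] at m1 m2 e1 e2
  rw [nablaForm, nablaForm, e1, e2, inner_sub_left, inner_sub_left,
    hJ.inner_apply_left x (leviCivita (extend E Y) x X)]
  rw [hJ.inner_apply_left, real_inner_comm (J x _) Y] at m1
  rw [real_inner_comm _ Y] at m2
  linarith

theorem nablaForm_J_mid (hJ : IsAlmostHermitian J) (x : M) (X Y Z : TangentSpace 𝓘(ℝ, E) x) :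
    nablaForm hJ x X (J x Y) Z = nablaForm hJ x X Y (J x Z) := by
  simp [nablaForm, nablaJ_apply_J, hJ.inner_apply_left]

theorem nablaForm_J_J (hJ : IsAlmostHermitian J) (x : M) (X Y Z : TangentSpace 𝓘(ℝ, E) x) :
    nablaForm hJ x X (J x Y) (J x Z) = -nablaForm hJ x X Y Z := by
  rw [nablaForm_J_mid, hJ.apply_apply]
  simp [nablaForm]

theorem nablaForm_self (hJ : IsAlmostHermitian J) (x : M) (X Y : TangentSpace 𝓘(ℝ, E) x) :
    nablaForm hJ x X Y Y = 0 := by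
  linarith [nablaForm_skew hJ x X Y Y]

theorem nablaForm_J_self (hJ : IsAlmostHermitian J) (x : M) (X Y : TangentSpace 𝓘(ℝ, E) x) :
    nablaForm hJ x X Y (J x Y) = 0 := by
  linarith [nablaForm_skew hJ x X Y (J x Y), nablaForm_J_mid hJ x X Y Y]

theorem nablaForm_neg_left (hJ : IsAlmostHermitian J) (x : M) (X Y Z : TangentSpace 𝓘(ℝ, E) x) :
    nablaForm hJ x (-X) Y Z = -nablaForm hJ x X Y Z := by
  simp [nablaForm]

theorem inner_chernDiff_eq (hJ : IsAlmostHermitian J) (x : M)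
    (X Y Z : TangentSpace 𝓘(ℝ, E) x) :
    (inner ℝ (chernDiff hJ x Y X) Z : ℝ) = 1 / 2 * nablaForm hJ x X (J x Y) Z
      + 1 / 4 * (nablaForm hJ x Z (J x Y) X - nablaForm hJ x Y (J x Z) X
        - nablaForm hJ x (J x Z) Y X + nablaForm hJ x (J x Y) Z X) := by
  simp [inner_chernDiff, chernForm, nablaForm, inner_add_left, inner_sub_left]

/-- Infinitesimally, this says that `∇^c` is metric, like `∇`. It serves to move an outer `A` onto
the factor `JY` in the curvature formulas. -/
theorem inner_chernDiff_skew (hJ : IsAlmostHermitian J) (x : M)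
    (X Y Z : TangentSpace 𝓘(ℝ, E) x) :
    (inner ℝ (chernDiff hJ x Y X) Z : ℝ) = -inner ℝ Y (chernDiff hJ x Z X) := by
  rw [real_inner_comm _ Y, inner_chernDiff_eq, inner_chernDiff_eq]
  linarith [nablaForm_J_mid hJ x X Y Z, nablaForm_skew hJ x X Y (J x Z)]

/-- The part of `∇^c_X Y - ∇_X Y` that is seen by the bisectional curvature. -/
theorem inner_chernDiff_J (hJ : IsAlmostHermitian J) (x : M) (X Y : TangentSpace 𝓘(ℝ, E) x) :
    (inner ℝ (chernDiff hJ x Y X) (J x Y) : ℝ) =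
      1 / 2 * (nablaForm hJ x Y Y X + nablaForm hJ x (J x Y) (J x Y) X) := by
  rw [inner_chernDiff_eq, nablaForm_self, hJ.apply_apply]
  rw [nablaForm_neg_left]
  simp only [nablaForm, map_neg, neg_apply, inner_neg_left]
  ring

/-! ### Comparison of the curvatures -/

theorem chern_apply (hJ : IsAlmostHermitian J) (Y : Π x : M, TangentSpace 𝓘(ℝ, E) x) (x : M)
    (v : TangentSpace 𝓘(ℝ, E) x) :
    chern hJ Y x v = leviCivita Y x v + chernDiff hJ x (Y x) v :=
  rfl

theorem leviCivita_add {Y Z : Π x : M, TangentSpace 𝓘(ℝ, E) x} {x : M}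
    (hY : MDiffAt (T% Y) x) (hZ : MDiffAt (T% Z) x) (v : TangentSpace 𝓘(ℝ, E) x) :
    leviCivita (fun y ↦ Y y + Z y) x v = leviCivita Y x v + leviCivita Z x v :=
  congrArg (fun f ↦ f v) (leviCivita.isCovariantDerivativeOnUniv.add hY hZ)

theorem leviCivita_sub_leviCivita {X Y : Π x : M, TangentSpace 𝓘(ℝ, E) x} {x : M}
    (hX : MDiffAt (T% X) x) (hY : MDiffAt (T% Y) x) :
    leviCivita Y x (X x) - leviCivita X x (Y x) = mlieBracket 𝓘(ℝ, E) X Y x :=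
  (CovariantDerivative.torsion_eq_zero_iff _).1 leviCivita_torsion hX hY

/-- Expand the second derivatives of `∇^c = ∇ + A`. The bracket is replaced by its torsion-free
expression, so that only `∇` and `A` remain. -/
theorem curvature_leviCivita_sub_curvature_chern (hJ : IsAlmostHermitian J)
    {U V W : Π x : M, TangentSpace 𝓘(ℝ, E) x} {x : M} (hU : CMDiffAt ∞ (T% U) x)
    (hV : CMDiffAt ∞ (T% V) x) (hW : CMDiffAt ∞ (T% W) x) :
    curvature leviCivita U V W x - curvature (chern hJ) U V W x =
      leviCivita (fun y ↦ chernDiff hJ y (W y) (V y)) x (U x)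
      - leviCivita (fun y ↦ chernDiff hJ y (W y) (U y)) x (V x)
      + chernDiff hJ x (leviCivita W x (V x)) (U x) - chernDiff hJ x (leviCivita W x (U x)) (V x)
      + chernDiff hJ x (chernDiff hJ x (W x) (V x)) (U x)
      - chernDiff hJ x (chernDiff hJ x (W x) (U x)) (V x)
      - chernDiff hJ x (W x) (leviCivita V x (U x) - leviCivita U x (V x)) := by
  have h0 : (∞ : WithTop ℕ∞) ≠ 0 := by simp
  have hU' := hU.mdifferentiableAt h0
  have hV' := hV.mdifferentiableAt h0
  have e1 := leviCivita_add ((contMDiffAt_leviCivita hV hW).mdifferentiableAt h0)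
    ((contMDiffAt_chernDiff hJ hV hW).mdifferentiableAt h0) (U x)
  have e2 := leviCivita_add ((contMDiffAt_leviCivita hU hW).mdifferentiableAt h0)
    ((contMDiffAt_chernDiff hJ hU hW).mdifferentiableAt h0) (V x)
  rw [leviCivita_sub_leviCivita hU' hV']
  simp only [curvature, chern_apply, e1, e2, map_add, add_apply]
  abel

theorem inner_leviCivita_eq {X Y Z : Π x : M, TangentSpace 𝓘(ℝ, E) x} {x : M}
    (hX : CMDiffAt ∞ (T% X) x) (hY : CMDiffAt ∞ (T% Y) x) (hZ : CMDiffAt ∞ (T% Z) x) :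
    (inner ℝ (leviCivita Y x (X x)) (Z x) : ℝ) =
      d% (fun y ↦ (inner ℝ (Y y) (Z y) : ℝ)) x (X x) - inner ℝ (Y x) (leviCivita Z x (X x)) := by
  have h0 : (∞ : WithTop ℕ∞) ≠ 0 := by simp
  rw [leviCivita_metric (hX.mdifferentiableAt h0) (hY.mdifferentiableAt h0)
    (hZ.mdifferentiableAt h0), add_sub_cancel_right]

theorem leviCivita_J (hJ : IsAlmostHermitian J) {Y : Π x : M, TangentSpace 𝓘(ℝ, E) x} {x : M}
    (hY : CMDiffAt ∞ (T% Y) x) (v : TangentSpace 𝓘(ℝ, E) x) :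
    leviCivita (fun y ↦ J y (Y y)) x v = nablaJ hJ x (Y x) v + J x (leviCivita Y x v) := by
  rw [nablaJ_apply hJ (hY.mdifferentiableAt (by simp)), sub_add_cancel]

/-! ### Quasi-Kähler manifolds -/

/-- Polarization only gives the part symmetric in `X, Y`. As `∇_X J` anticommutes with `J`, the
polarized identity at `(JX, Y)`, after applying `J`, is an independent relation; subtracting it from
the one at `(X, Y)` eliminates the swapped terms. -/
theorem nablaJ_J_J_of_nablaJ_self (hJ : IsAlmostHermitian J) {x : M}
    (h : ∀ X : TangentSpace 𝓘(ℝ, E) x, nablaJ hJ x X X = -nablaJ hJ x (J x X) (J x X))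
    (X Y : TangentSpace 𝓘(ℝ, E) x) : nablaJ hJ x (J x Y) (J x X) = -nablaJ hJ x Y X := by
  have hp (X Y : TangentSpace 𝓘(ℝ, E) x) : nablaJ hJ x Y X + nablaJ hJ x X Y =
      -(nablaJ hJ x (J x Y) (J x X) + nablaJ hJ x (J x X) (J x Y)) := by
    have h1 := h (X + Y)
    simp only [map_add, add_apply, h X, h Y] at h1
    linear_combination (norm := module) h1
  have h1 := hp X Y
  have h2 := congrArg (J x) (hp (J x X) Y)
  simp only [hJ.apply_apply, nablaJ_apply_J, map_neg, map_add, neg_apply, neg_neg] at h1 h2 ⊢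
  have h3 : (2 : ℝ) • (nablaJ hJ x Y X - J x (nablaJ hJ x Y (J x X))) = 0 := by
    linear_combination (norm := module) h1 - h2
  rw [smul_eq_zero_iff_right two_ne_zero, sub_eq_zero] at h3
  rw [h3]

theorem nablaForm_J_left_of_quasiKahler (hJ : IsAlmostHermitian J) {x : M}
    (h : ∀ X : TangentSpace 𝓘(ℝ, E) x, nablaJ hJ x X X = -nablaJ hJ x (J x X) (J x X))
    (X Y Z : TangentSpace 𝓘(ℝ, E) x) :
    nablaForm hJ x (J x X) Y Z = nablaForm hJ x X (J x Y) Z := by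
  have h1 := nablaJ_J_J_of_nablaJ_self hJ h X (J x Y)
  rw [hJ.apply_apply, map_neg, neg_apply, neg_inj] at h1
  rw [nablaForm, h1, nablaForm]

/-- Moving `J` from the differentiation slot to the next one makes the four terms of `chernForm`
cancel in pairs. -/
theorem chernDiff_eq_of_quasiKahler (hJ : IsAlmostHermitian J) {x : M}
    (h : ∀ X : TangentSpace 𝓘(ℝ, E) x, nablaJ hJ x X X = -nablaJ hJ x (J x X) (J x X))
    (X Y : TangentSpace 𝓘(ℝ, E) x) :
    chernDiff hJ x Y X = -(1 / 2 : ℝ) • J x (nablaJ hJ x Y X) := by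
  refine ext_inner_right ℝ fun Z ↦ ?_
  rw [inner_chernDiff_eq, nablaForm_J_left_of_quasiKahler hJ h Z Y X,
    nablaForm_J_left_of_quasiKahler hJ h Y Z X, nablaForm, nablaJ_apply_J, inner_smul_left,
    inner_neg_left]
  simp

/-- The right-hand side is definite, so equality of the curvatures forces `(∇_X J)Y = 0`. -/
theorem bisectionalCurvature_sub_of_quasiKahler (hJ : IsAlmostHermitian J)
    (h : ∀ (x : M) (X : TangentSpace 𝓘(ℝ, E) x),
      nablaJ hJ x X X = -nablaJ hJ x (J x X) (J x X))
    (x : M) (X Y : TangentSpace 𝓘(ℝ, E) x) :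
    holomorphicBisectionalCurvature J x X Y - hermitianBisectionalCurvature hJ x X Y =
      1 / 2 * inner ℝ (nablaJ hJ x Y X) (nablaJ hJ x Y X) := by
  have hU := contMDiffAt_extend' x X
  have hV := contMDiffAt_extend' x (J x X)
  have hW := contMDiffAt_extend' x Y
  have hJW := hJ.contMDiffAt_apply hW
  -- This holds at every point, so the function may be differentiated; it also kills the bracket
  -- term.
  have hq (y : M) (v w : TangentSpace 𝓘(ℝ, E) y) :
      (inner ℝ (chernDiff hJ y w v) (J y w) : ℝ) = 0 := by
    rw [inner_chernDiff_J, nablaForm, nablaForm, h y w, inner_neg_left]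
    ring
  have i1 := inner_leviCivita_eq hU (contMDiffAt_chernDiff hJ hV hW) hJW
  have i2 := inner_leviCivita_eq hV (contMDiffAt_chernDiff hJ hU hW) hJW
  simp only [hq, mvfderiv_const, leviCivita_J hJ hW, extend_apply_self] at i1 i2
  have hs (v w : TangentSpace 𝓘(ℝ, E) x) := inner_chernDiff_skew hJ x v w (J x Y)
  have hN : nablaJ hJ x Y (J x X) = -J x (nablaJ hJ x Y X) := by
    have := nablaJ_J_J_of_nablaJ_self hJ (h x) (J x X) Y
    rw [hJ.apply_apply, map_neg, nablaJ_apply_J] at this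
    exact (neg_inj.1 this).symm
  rw [holomorphicBisectionalCurvature, hermitianBisectionalCurvature, bisectionalCurvature,
    bisectionalCurvature, curvatureAt, curvatureAt, ← inner_sub_left,
    curvature_leviCivita_sub_curvature_chern hJ hU hV hW]
  simp only [extend_apply_self, inner_sub_left, inner_add_left, hq, hs, i1, i2]
  -- With `Q = (∇_X J)Y`, the derivative terms contribute `|Q|²` and the terms quadratic in `A`
  -- contribute `-1/2 |Q|²`; the terms containing `∇_X Y` and `∇_{JX} Y` cancel.
  simp only [chernDiff_eq_of_quasiKahler hJ (h x), nablaJ_apply_J, hN, map_neg, hJ.apply_apply,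
    inner_add_right, inner_neg_left, inner_neg_right, inner_smul_left, inner_smul_right,
    hJ.inner_apply_left]
  have c1 : (inner ℝ (nablaJ hJ x Y X) (J x (leviCivita (extend E Y) x X)) : ℝ) =
      -inner ℝ (leviCivita (extend E Y) x X) (J x (nablaJ hJ x Y X)) := by
    rw [real_inner_comm, hJ.inner_apply_left]
  rw [c1, real_inner_comm (leviCivita (extend E Y) x (J x X))]
  simp only [map_div₀, map_one, map_ofNat, zero_apply]
  ring

/-! ### Almost Hermitian manifolds of class `G₁` -/

section

variable {x : M}

theorem nablaForm_J_left_of_classG1 (hJ : IsAlmostHermitian J)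
    (h : ∀ X : TangentSpace 𝓘(ℝ, E) x, nablaJ hJ x X X = nablaJ hJ x (J x X) (J x X))
    (X Z : TangentSpace 𝓘(ℝ, E) x) :
    nablaForm hJ x (J x X) X Z = -nablaForm hJ x X X (J x Z) := by
  have h1 := nablaForm_J_J hJ x (J x X) X Z
  rw [nablaForm, nablaForm, ← h X] at h1
  rw [nablaForm, nablaForm]
  linarith

theorem chernDiff_self_of_classG1 (hJ : IsAlmostHermitian J)
    (h : ∀ X : TangentSpace 𝓘(ℝ, E) x, nablaJ hJ x X X = nablaJ hJ x (J x X) (J x X))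
    (X : TangentSpace 𝓘(ℝ, E) x) : chernDiff hJ x X X = -J x (nablaJ hJ x X X) := by
  refine ext_inner_right ℝ fun Z ↦ ?_
  have h1 := nablaForm_J_left_of_classG1 hJ h X Z
  have h2 := nablaForm_skew hJ x X (J x Z) X
  have h3 := nablaForm_skew hJ x (J x X) Z X
  have h4 := nablaForm_J_mid hJ x Z X X
  rw [inner_neg_left, hJ.inner_apply_left, inner_chernDiff_eq, nablaForm_self hJ x (J x Z) X,
    nablaForm_J_mid hJ x X X Z, h4, nablaForm_J_self, neg_neg]
  change _ = nablaForm hJ x X X (J x Z)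
  linarith

theorem chernDiff_self_J_of_classG1 (hJ : IsAlmostHermitian J)
    (h : ∀ X : TangentSpace 𝓘(ℝ, E) x, nablaJ hJ x X X = nablaJ hJ x (J x X) (J x X))
    (X : TangentSpace 𝓘(ℝ, E) x) : chernDiff hJ x X (J x X) = 0 := by
  refine ext_inner_right ℝ fun Z ↦ ?_
  have h1 := nablaForm_J_left_of_classG1 hJ h X (J x Z)
  have h2 := nablaForm_skew hJ x X (J x Z) (J x X)
  have h3 := nablaForm_J_J hJ x X X Z
  have h4 := nablaForm_skew hJ x (J x X) Z (J x X)
  have h5 := nablaForm_J_mid hJ x (J x X) X Z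
  rw [inner_zero_left, inner_chernDiff_eq, nablaForm_self hJ x Z,
    nablaForm_J_self hJ x (J x Z) X]
  rw [hJ.apply_apply] at h1
  simp only [nablaForm, inner_neg_right] at *
  linarith

theorem chernDiff_J_self_of_classG1 (hJ : IsAlmostHermitian J)
    (h : ∀ X : TangentSpace 𝓘(ℝ, E) x, nablaJ hJ x X X = nablaJ hJ x (J x X) (J x X))
    (X : TangentSpace 𝓘(ℝ, E) x) : chernDiff hJ x (J x X) X = 0 := by
  have h1 := chernDiff_self_J_of_classG1 hJ h (J x X)
  rwa [hJ.apply_apply, map_neg, neg_eq_zero] at h1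

end

/-- In class `G₁`, the holomorphic sectional curvature and its Hermitian counterpart differ by
`‖(∇_X J) X‖²`. -/
theorem holomorphicSectionalCurvature_sub_of_classG1 (hJ : IsAlmostHermitian J)
    (h : ∀ (x : M) (X : TangentSpace 𝓘(ℝ, E) x),
      nablaJ hJ x X X = nablaJ hJ x (J x X) (J x X))
    (x : M) (X : TangentSpace 𝓘(ℝ, E) x) :
    holomorphicBisectionalCurvature J x X X - hermitianBisectionalCurvature hJ x X X =
      -inner ℝ (nablaJ hJ x X X) (nablaJ hJ x X X) := by
  have hU := contMDiffAt_extend' x X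
  have hV := contMDiffAt_extend' x (J x X)
  have hJU := hJ.contMDiffAt_apply hU
  have hP := contMDiffAt_nablaJ hJ hU hU
  have hq (y : M) (v w : TangentSpace 𝓘(ℝ, E) y) :
      (inner ℝ (chernDiff hJ y w v) (J y w) : ℝ) = inner ℝ (nablaJ hJ y w w) v := by
    rw [inner_chernDiff_J, nablaForm, nablaForm, ← h y w]
    ring
  have hPU (y : M) (v : TangentSpace 𝓘(ℝ, E) y) : (inner ℝ (nablaJ hJ y v v) v : ℝ) = 0 :=
    nablaForm_self hJ y v v
  have hPJU (y : M) (v : TangentSpace 𝓘(ℝ, E) y) :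
      (inner ℝ (nablaJ hJ y v v) (J y v) : ℝ) = 0 :=
    nablaForm_J_self hJ y v v
  have i1 := inner_leviCivita_eq hU (contMDiffAt_chernDiff hJ hV hU) hJU
  have i2 := inner_leviCivita_eq hV (contMDiffAt_chernDiff hJ hU hU) hJU
  -- The extension `V` of `JX` agrees with `JU` only at `x`, so `g(P, V)` need not vanish nearby.
  -- Comparing `g(∇_U P, V)` with `g(∇_U P, JU)` at `x`, where `g(P, JU) = 0` identically, expresses
  -- the derivative of `g(P, V)` without derivatives of `P`. The resulting `g(P, ∇_U V)` cancels
  -- against the bracket term.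
  have i3 := inner_leviCivita_eq hU hP hV
  have i4 := inner_leviCivita_eq hU hP hJU
  have hN : nablaJ hJ x X (J x X) = J x (nablaJ hJ x X X) := by
    rw [h x X, nablaJ_apply_J, map_neg, hJ.apply_apply, neg_neg]
  simp only [hq, hPU, hPJU, mvfderiv_const, leviCivita_J hJ hU, extend_apply_self,
    chernDiff_self_of_classG1 hJ (h x), chernDiff_self_J_of_classG1 hJ (h x), hN,
    inner_zero_left, zero_apply, sub_zero] at i1 i2 i3 i4
  rw [← i1, i4] at i3
  have hs (v w : TangentSpace 𝓘(ℝ, E) x) := inner_chernDiff_skew hJ x v w (J x X)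
  rw [holomorphicBisectionalCurvature, hermitianBisectionalCurvature, bisectionalCurvature,
    bisectionalCurvature, curvatureAt, curvatureAt, ← inner_sub_left,
    curvature_leviCivita_sub_curvature_chern hJ hU hV hU]
  simp only [extend_apply_self, inner_sub_left, inner_add_left, i2]
  have c1 : (inner ℝ (nablaJ hJ x X X) (J x (leviCivita (extend E X) x X)) : ℝ) =
      -inner ℝ (leviCivita (extend E X) x X) (J x (nablaJ hJ x X X)) := by
    rw [real_inner_comm, hJ.inner_apply_left]
  have c2 : chernDiff hJ x (J x X) (J x X) = -J x (nablaJ hJ x X X) := by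
    rw [chernDiff_self_of_classG1 hJ (h x), ← h x]
  rw [hq, hs X (leviCivita (extend E X) x (J x X)), hs (J x X) (leviCivita (extend E X) x X),
    hs (J x X) (chernDiff hJ x X X), chernDiff_self_J_of_classG1 hJ (h x),
    chernDiff_J_self_of_classG1 hJ (h x), c2, chernDiff_self_of_classG1 hJ (h x)]
  simp only [inner_neg_left, inner_neg_right, inner_add_right, inner_sub_right, inner_zero_right,
    map_zero, zero_apply, inner_zero_left, hJ.inner_apply] at i3 ⊢
  linarith

/-! ### Kähler manifolds -/

theorem kahlerForm_eq (X Y : Π x : M, TangentSpace 𝓘(ℝ, E) x) :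
    kahlerForm J X Y = fun y ↦ (inner ℝ (J y (X y)) (Y y) : ℝ) :=
  rfl

/-- Writing each bracket as `∇_X Y - ∇_Y X` makes all derivatives of the fields cancel, leaving only
`∇J`. -/
theorem nijenhuis_eq (hJ : IsAlmostHermitian J) {X Y : Π x : M, TangentSpace 𝓘(ℝ, E) x} {x : M}
    (hX : CMDiffAt ∞ (T% X) x) (hY : CMDiffAt ∞ (T% Y) x) :
    nijenhuis J X Y x = nablaJ hJ x (Y x) (J x (X x)) - J x (nablaJ hJ x (Y x) (X x))
      - (nablaJ hJ x (X x) (J x (Y x)) - J x (nablaJ hJ x (X x) (Y x))) := by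
  have h0 : (∞ : WithTop ℕ∞) ≠ 0 := by simp
  have hJX := hJ.contMDiffAt_apply hX
  have hJY := hJ.contMDiffAt_apply hY
  rw [nijenhuis, ← leviCivita_sub_leviCivita (hJX.mdifferentiableAt h0) (hJY.mdifferentiableAt h0),
    ← leviCivita_sub_leviCivita (hJX.mdifferentiableAt h0) (hY.mdifferentiableAt h0),
    ← leviCivita_sub_leviCivita (hX.mdifferentiableAt h0) (hJY.mdifferentiableAt h0),
    ← leviCivita_sub_leviCivita (hX.mdifferentiableAt h0) (hY.mdifferentiableAt h0)]
  simp only [leviCivita_J hJ hX, leviCivita_J hJ hY, map_sub, map_add, hJ.apply_apply]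
  abel

theorem dKahlerForm_eq (hJ : IsAlmostHermitian J) {X Y Z : Π x : M, TangentSpace 𝓘(ℝ, E) x}
    {x : M} (hX : CMDiffAt ∞ (T% X) x) (hY : CMDiffAt ∞ (T% Y) x) (hZ : CMDiffAt ∞ (T% Z) x) :
    dKahlerForm J X Y Z x = nablaForm hJ x (X x) (Y x) (Z x) + nablaForm hJ x (Y x) (Z x) (X x)
      + nablaForm hJ x (Z x) (X x) (Y x) := by
  have h0 : (∞ : WithTop ℕ∞) ≠ 0 := by simp
  have e1 := inner_leviCivita_eq hX (hJ.contMDiffAt_apply hY) hZ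
  have e2 := inner_leviCivita_eq hY (hJ.contMDiffAt_apply hZ) hX
  have e3 := inner_leviCivita_eq hZ (hJ.contMDiffAt_apply hX) hY
  simp only [dKahlerForm, kahlerForm_eq,
    ← leviCivita_sub_leviCivita (hX.mdifferentiableAt h0) (hY.mdifferentiableAt h0),
    ← leviCivita_sub_leviCivita (hY.mdifferentiableAt h0) (hZ.mdifferentiableAt h0),
    ← leviCivita_sub_leviCivita (hZ.mdifferentiableAt h0) (hX.mdifferentiableAt h0)]
  simp only [leviCivita_J hJ hX, leviCivita_J hJ hY, leviCivita_J hJ hZ, inner_add_left] at e1 e2 e3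
  simp only [nablaForm, map_sub, inner_sub_left]
  have c (v w : TangentSpace 𝓘(ℝ, E) x) : (inner ℝ (J x v) w : ℝ) = -inner ℝ (J x w) v := by
    rw [hJ.inner_apply_left, real_inner_comm]
  linarith [c (leviCivita Z x (X x)) (Y x), c (leviCivita X x (Y x)) (Z x),
    c (leviCivita Y x (Z x)) (X x)]

theorem IsAlmostHermitian.isKahler_of_nablaJ_eq_zero (hJ : IsAlmostHermitian J)
    (h : ∀ (x : M) (X Y : TangentSpace 𝓘(ℝ, E) x), nablaJ hJ x Y X = 0) : IsKahler J where
  toIsAlmostHermitian := hJ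
  nijenhuis_eq_zero x X Y hX hY := by simp [nijenhuis_eq hJ hX hY, h]
  dKahlerForm_eq_zero x X Y Z hX hY hZ := by simp [dKahlerForm_eq hJ hX hY hZ, nablaForm, h]

theorem IsKahler.nablaJ_eq_zero (hK : IsKahler J) (hJ : IsAlmostHermitian J) (x : M)
    (X Y : TangentSpace 𝓘(ℝ, E) x) : nablaJ hJ x Y X = 0 := by
  have hsym (X Y Z : TangentSpace 𝓘(ℝ, E) x) :
      nablaForm hJ x (J x X) Y Z + nablaForm hJ x X Y (J x Z) =
        nablaForm hJ x (J x Y) X Z + nablaForm hJ x Y X (J x Z) := by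
    have h1 := hK.nijenhuis_eq_zero x _ _ (contMDiffAt_extend' x X) (contMDiffAt_extend' x Y)
    rw [nijenhuis_eq hJ (contMDiffAt_extend' x X) (contMDiffAt_extend' x Y)] at h1
    have h2 := congrArg (fun v ↦ (inner ℝ v Z : ℝ)) h1
    simp only [extend_apply_self, inner_sub_left, hJ.inner_apply_left, inner_zero_left] at h2
    simp only [nablaForm]
    linarith
  have hskew (X Y Z : TangentSpace 𝓘(ℝ, E) x) :
      nablaForm hJ x (J x X) Y Z + nablaForm hJ x X Y (J x Z) =
        -(nablaForm hJ x (J x X) Z Y + nablaForm hJ x X Z (J x Y)) := by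
    linarith [nablaForm_skew hJ x (J x X) Y Z, nablaForm_skew hJ x X Y (J x Z),
      nablaForm_J_mid hJ x X Z Y]
  -- The form `g((∇_{JX} J)Y, Z) + g((∇_X J)Y, JZ)` is symmetric in `X, Y` and skew in `Y, Z`, hence
  -- zero.
  have hJl (X Y Z : TangentSpace 𝓘(ℝ, E) x) :
      nablaForm hJ x (J x X) Y Z = -nablaForm hJ x X Y (J x Z) := by
    linarith [hsym X Y Z, hskew Y X Z, hsym Y Z X, hskew Z Y X, hsym Z X Y, hskew X Z Y]
  have hcyc (X Y Z : TangentSpace 𝓘(ℝ, E) x) :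
      nablaForm hJ x X Y Z + nablaForm hJ x Y Z X + nablaForm hJ x Z X Y = 0 := by
    have h1 := hK.dKahlerForm_eq_zero x _ _ _ (contMDiffAt_extend' x X) (contMDiffAt_extend' x Y)
      (contMDiffAt_extend' x Z)
    rw [dKahlerForm_eq hJ (contMDiffAt_extend' x X) (contMDiffAt_extend' x Y)
      (contMDiffAt_extend' x Z)] at h1
    simpa only [extend_apply_self] using h1
  refine ext_inner_right ℝ fun Z ↦ ?_
  rw [inner_zero_left]
  change nablaForm hJ x X Y Z = 0
  -- Replacing `(Y, Z)` by `(JY, JZ)` in the cyclic sum preserves the two terms differentiated along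
  -- `Y` and `Z` and reverses the sign of the one along `X`. The difference of the two sums is `2
  -- g((∇_X J)Y, Z)`.
  have h1 := hcyc Y Z X
  have h2 := hcyc (J x Y) (J x Z) X
  have h3 := hJl Y (J x Z) X
  have h4 := nablaForm_J_J hJ x Y Z X
  have h5 := hJl Z X (J x Y)
  have h6 := nablaForm_J_J hJ x X Y Z
  have h7 : nablaForm hJ x Z X (-Y) = -nablaForm hJ x Z X Y := by simp [nablaForm]
  rw [hJ.apply_apply] at h5
  linarith

theorem IsKahler.holomorphicBisectionalCurvature_eq (hK : IsKahler J) (hJ : IsAlmostHermitian J)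
    (x : M) (X Y : TangentSpace 𝓘(ℝ, E) x) :
    holomorphicBisectionalCurvature J x X Y = hermitianBisectionalCurvature hJ x X Y := by
  have h := bisectionalCurvature_sub_of_quasiKahler hJ
    (fun x X ↦ by simp [hK.nablaJ_eq_zero hJ]) x X Y
  rwa [hK.nablaJ_eq_zero hJ, inner_zero_left, mul_zero, sub_eq_zero] at h

/-- The curvatures are compared on unit vectors only; rescaling extends the vanishing of `∇J` to all
vectors. -/
theorem eq_zero_of_homogeneous_of_unit {x : M} (f : TangentSpace 𝓘(ℝ, E) x → TangentSpace 𝓘(ℝ, E) x)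
    (n : ℕ) (hn : n ≠ 0) (hf : ∀ (c : ℝ) (v : TangentSpace 𝓘(ℝ, E) x), f (c • v) = c ^ n • f v)
    (h : ∀ v : TangentSpace 𝓘(ℝ, E) x, (inner ℝ v v : ℝ) = 1 → f v = 0)
    (v : TangentSpace 𝓘(ℝ, E) x) : f v = 0 := by
  by_cases hv : v = 0
  · simpa [hv, hn] using hf 0 0
  · have h0 : ‖v‖ ≠ 0 := norm_ne_zero_iff.2 hv
    have h1 := h (‖v‖⁻¹ • v) (by
      rw [inner_smul_left, inner_smul_right, real_inner_self_eq_norm_sq]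
      simp
      field_simp)
    rw [hf] at h1
    exact (smul_eq_zero.1 h1).resolve_left (pow_ne_zero n (inv_ne_zero h0))

end

end AlmostHermitian

end

open AlmostHermitian in
theorem theorem8p9 {E : Type*} [NormedAddCommGroup E] [NormedSpace ℝ E] [FiniteDimensional ℝ E]
    {M : Type*} [TopologicalSpace M] [ChartedSpace E M] [IsManifold 𝓘(ℝ, E) ∞ M]
    [RiemannianBundle (fun x : M ↦ TangentSpace 𝓘(ℝ, E) x)]
    [IsContMDiffRiemannianBundle 𝓘(ℝ, E) ∞ E (fun x : M ↦ TangentSpace 𝓘(ℝ, E) x)]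
    (J : Π x : M, TangentSpace 𝓘(ℝ, E) x →L[ℝ] TangentSpace 𝓘(ℝ, E) x)
    (hJ : IsAlmostHermitian J)
    (ε : ℝ) (hε : ε = 1 ∨ ε = -1)
    (hGray : ∀ (x : M) (X : TangentSpace 𝓘(ℝ, E) x),
      nablaJ hJ x X X = ε • nablaJ hJ x (J x X) (J x X)) :
    (∀ (x : M) (X Y : TangentSpace 𝓘(ℝ, E) x),
        (inner ℝ X X : ℝ) = 1 → (inner ℝ Y Y : ℝ) = 1 →
          holomorphicBisectionalCurvature J x X Y = hermitianBisectionalCurvature hJ x X Y) ↔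
      IsKahler J := by
  refine ⟨fun h ↦ ?_, fun hK x X Y _ _ ↦ hK.holomorphicBisectionalCurvature_eq hJ x X Y⟩
  have hquasi : ∀ (x : M) (X : TangentSpace 𝓘(ℝ, E) x),
      nablaJ hJ x X X = -nablaJ hJ x (J x X) (J x X) := by
    rcases hε with rfl | rfl
    -- For `ε = 1` the diagonal case makes `(∇_X J)X` vanish, so both sides of the quasi-Kähler
    -- condition are zero.
    · simp only [one_smul] at hGray
      have h0 (x : M) (X : TangentSpace 𝓘(ℝ, E) x) : nablaJ hJ x X X = 0 := by
        refine eq_zero_of_homogeneous_of_unit (fun X ↦ nablaJ hJ x X X) 2 two_ne_zero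
          (fun c v ↦ by simp [smul_smul, pow_two]) (fun v hv ↦ ?_) X
        have h1 := holomorphicSectionalCurvature_sub_of_classG1 hJ hGray x v
        rw [h x v v hv hv, sub_self, zero_eq_neg, inner_self_eq_zero] at h1
        exact h1
      simp [h0]
    · simpa using hGray
  refine hJ.isKahler_of_nablaJ_eq_zero fun x X Y ↦ ?_
  refine eq_zero_of_homogeneous_of_unit (fun Y ↦ nablaJ hJ x Y X) 1 one_ne_zero
    (fun c v ↦ by simp) (fun Y hY ↦ ?_) Y
  refine eq_zero_of_homogeneous_of_unit (fun X ↦ nablaJ hJ x Y X) 1 one_ne_zero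
    (fun c v ↦ by simp) (fun X hX ↦ ?_) X
  have h1 := bisectionalCurvature_sub_of_quasiKahler hJ hquasi x X Y
  rw [h x X Y hX hY, sub_self, zero_eq_mul, inner_self_eq_zero] at h1
  exact h1.resolve_left (by norm_num)
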